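/- For real $\nu$ and $x>0$ let $$I_\nu(x)=\sum_{k=0}^\infty\frac{(x/2)^{2k+\nu}}{k!\,\Gamma(\nu+k+1)},\qquad K_\nu(x)=\int_0^\infty e^{-x\cosh t}\cosh(\nu t)\,dt$$ be the modified Bessel functions of the first and second kind. The integrals $\int_0^x e^{\beta t}t^{\nu+1}I_\nu(t)\,dt$ and $\int_0^x e^{\beta t}t^{\nu}I_\nu(t)\,dt$ converge for all real $\beta$, all $\nu>-\frac12$ and all $x\ge0$, and the following inequalities hold; at $x=0$ each left-hand side is understood as its limit as $x\downarrow0$, which exists. (i) Let $\beta\ge0$ and $\nu>-\frac12$. Then, for all $x\ge0$, $$\frac{e^{-\beta x}K_{\nu+1}(x)}{x^{\nu}}\int_0^x e^{\beta t}t^{\nu+1}I_\nu(t)\,dt<\frac12,\qquad \frac{e^{-\beta x}K_{\nu}(x)}{x^{\nu}}\int_0^x e^{\beta t}t^{\nu+1}I_\nu(t)\,dt<\frac12.$$ (ii) Let $\beta\ge0$ and $\nu>-\frac12$. Then, for all $x\ge0$, $$\frac{e^{-\beta x}K_{\nu+1}(x)}{x^{\nu-1}}\int_0^x e^{\beta t}t^{\nu}I_\nu(t)\,dt<\frac{\nu+1}{2\nu+1},\qquad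 \frac{e^{-\beta x}K_{\nu}(x)}{x^{\nu-1}}\int_0^x e^{\beta t}t^{\nu}I_\nu(t)\,dt<\frac{\nu+1}{2\nu+1}.$$ (iii) Let $-1<\beta<0$ and $\nu>-\frac12$. Then, for all $x\ge0$, $$\frac{e^{-\beta x}K_{\nu+1}(x)}{x^{\nu}}\int_0^x e^{\beta t}t^{\nu+1}I_\nu(t)\,dt<\frac1{2(1+\beta)},\qquad \frac{e^{-\beta x}K_{\nu}(x)}{x^{\nu}}\int_0^x e^{\beta t}t^{\nu+1}I_\nu(t)\,dt<\frac1{2(1+\beta)}.$$ (iv) Let $-1<\beta<0$ and $\nu\ge\frac12$. Then, for all $x\ge0$, $$\frac{e^{-\beta x}K_{\nu+1}(x)}{x^{\nu-1}}\int_0^x e^{\beta t}t^{\nu}I_\nu(t)\,dt<\frac{\nu+1}{(2\nu+1)(1+\beta)},\qquad \frac{e^{-\beta x}K_{\nu}(x)}{x^{\nu-1}}\int_0^x e^{\beta t}t^{\nu}I_\nu(t)\,dt<\frac{\nu+1}{(2\nu+1)(1+\beta)}.$$ -/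

import Mathlib

open Set Filter Topology MeasureTheory

/-- The modified Bessel function of the first kind
`I_ν(x) = ∑_{k ≥ 0} (x/2)^(2k+ν) / (k! Γ(ν+k+1))`, of real order `ν`, for `x > 0`. -/
noncomputable def besselI (ν x : ℝ) : ℝ :=
  ∑' k : ℕ, (x / 2) ^ (2 * (k : ℝ) + ν) / ((k.factorial : ℝ) * Real.Gamma (ν + (k : ℝ) + 1))

/-- The modified Bessel function of the second kind
`K_ν(x) = ∫_0^∞ exp(-x cosh t) cosh(ν t) dt`, of real order `ν`, for `x > 0`. -/
noncomputable def besselK (ν x : ℝ) : ℝ :=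
  ∫ t in Ioi (0 : ℝ), Real.exp (-x * Real.cosh t) * Real.cosh (ν * t)

/-- `F(x) < C` for all `x ≥ 0`, for an expression `F` given by a formula on `x > 0` whose value at
`x = 0` is its limit as `x ↓ 0` (in particular that limit exists). -/
def LtOnNonneg (F : ℝ → ℝ) (C : ℝ) : Prop :=
  (∀ x : ℝ, 0 < x → F x < C) ∧ ∃ F₀ : ℝ, Tendsto F (𝓝[>] 0) (𝓝 F₀) ∧ F₀ < C

/-! Every case reduces to a product estimate x K_μ(x) I_μ(x) < 1/2 with μ = ν + 1 > 1/2.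

Integral side: for a = 1 or a = 0, a multiple S(t) of t^(ν+a) I_{ν+1}(t) has derivative at least
t^(ν+a) I_ν(t). Comparing the integrand with the derivative of exp(βt) S(t) bounds the integral by
(1 + min β 0)⁻¹ κ exp(βx) x^(ν+a) I_{ν+1}(x), with κ = 1 for a = 1 and κ = 2(ν+1)/(2ν+1) for a = 0
(`integral_exp_mul_rpow_mul_besselI_le`). When β < 0 this also needs S ≤ S', which is a ratio bound
on I_{ν+1}/I_ν. Multiplying by the prefactor leaves a constant times x K_{ν+1} I_{ν+1}; the versions
with K_ν follow from K_ν ≤ K_{ν+1}.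

Product side: the Wronskian gives x (I_μ K_{μ+1} + I_{μ+1} K_μ) ≤ 1
(`besselPhi_mul_besselK_add_le`). For μ ≥ 1/2, K_{μ+1}/K_μ ≥ (x + μ + 1/2)/x (`besselK_succ_ge`) and
I_{μ+1}/I_μ > (x - μ - 1/2)/x (`besselPhi_lower_ratio`). The two right-hand sides add up to 2, so 2
x I_μ K_μ < 1.

Working with the entire series `besselPhi` in place of I_ν keeps everything regular at 0, where the
initial values are read off. -/

/-! ### The power series of I_ν -/

/-- The entire function `∑ z^k / (k! Γ(ν+k+1))`, so that `I_ν(x) = (x/2)^ν besselPhi ν (x²/4)`. -/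
noncomputable def besselPhi (ν z : ℝ) : ℝ :=
  ∑' k : ℕ, z ^ k / ((k.factorial : ℝ) * Real.Gamma (ν + (k : ℝ) + 1))

theorem Gamma_nat_shift_pos {ν : ℝ} (hν : -1 < ν) (k : ℕ) : 0 < Real.Gamma (ν + (k : ℝ) + 1) :=
  Real.Gamma_pos_of_pos (by have : (0 : ℝ) ≤ k := k.cast_nonneg; linarith)

theorem exists_Gamma_nat_shift_lower_bound {ν : ℝ} (hν : -1 < ν) :
    ∃ c : ℝ, 0 < c ∧ ∀ k : ℕ, c ≤ Real.Gamma (ν + (k : ℝ) + 1) := by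
  have h : ∀ k : ℕ, Real.Gamma (ν + 1 + 1) ≤ Real.Gamma (ν + ((k + 1 : ℕ) : ℝ) + 1) := by
    intro k
    induction k with
    | zero => simp
    | succ k ih =>
      have hk : (0 : ℝ) ≤ k := k.cast_nonneg
      have hpos := Gamma_nat_shift_pos hν (k + 1)
      have e : ν + ((k + 1 + 1 : ℕ) : ℝ) + 1 = (ν + ((k + 1 : ℕ) : ℝ) + 1) + 1 := by
        push_cast; ring
      have hs := Real.Gamma_add_one (s := ν + ((k + 1 : ℕ) : ℝ) + 1) (by push_cast; linarith)
      rw [e, hs]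
      refine ih.trans (le_mul_of_one_le_left hpos.le ?_)
      push_cast; linarith
  -- The first step Γ(ν+1) → Γ(ν+2) multiplies by ν + 1, possibly below 1; all later factors exceed
  -- 1. Hence the minimum of these two values.
  refine ⟨min (Real.Gamma (ν + 1)) (Real.Gamma (ν + 1 + 1)),
    lt_min (Real.Gamma_pos_of_pos (by linarith)) (Real.Gamma_pos_of_pos (by linarith)), ?_⟩
  rintro (_ | k)
  · simp
  · exact (min_le_right _ _).trans (h k)

theorem summable_besselPhi {ν : ℝ} (hν : -1 < ν) (z : ℝ) :
    Summable fun k : ℕ => z ^ k / ((k.factorial : ℝ) * Real.Gamma (ν + (k : ℝ) + 1)) := by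
  obtain ⟨c, hc, h⟩ := exists_Gamma_nat_shift_lower_bound hν
  refine Summable.of_norm_bounded (g := fun k : ℕ => c⁻¹ * (|z| ^ k / (k.factorial : ℝ)))
    ((Real.summable_pow_div_factorial |z|).mul_left _) fun k => ?_
  have hf : (0 : ℝ) < k.factorial := by exact_mod_cast k.factorial_pos
  have hg := Gamma_nat_shift_pos hν k
  rw [Real.norm_eq_abs, abs_div, abs_pow, abs_of_pos (mul_pos hf hg), inv_mul_eq_div, div_div]
  exact div_le_div_of_nonneg_left (by positivity) (by positivity)
    (mul_le_mul_of_nonneg_left (h k) hf.le)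

theorem besselPhi_pos {ν z : ℝ} (hν : -1 < ν) (hz : 0 ≤ z) : 0 < besselPhi ν z := by
  have hnn : ∀ k : ℕ, 0 ≤ z ^ k / ((k.factorial : ℝ) * Real.Gamma (ν + (k : ℝ) + 1)) := fun k =>
    div_nonneg (pow_nonneg hz k) (mul_nonneg (Nat.cast_nonneg _) (Gamma_nat_shift_pos hν k).le)
  refine (summable_besselPhi hν z).tsum_pos hnn 0 ?_
  have := Gamma_nat_shift_pos hν 0
  simpa using this

theorem besselPhi_zero (ν : ℝ) : besselPhi ν 0 = (Real.Gamma (ν + 1))⁻¹ := by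
  unfold besselPhi
  rw [tsum_eq_single 0 (fun k hk => by simp [hk])]
  simp

/-- Compare coefficients: Γ(ν+k+2) = (ν+k+1) Γ(ν+k+1), and ν+k+1 splits as (ν+1) + k. The factor k
cancels against k!, and the index shift produces z times the series of order ν + 2. -/
theorem besselPhi_recurrence {ν : ℝ} (hν : -1 < ν) (z : ℝ) :
    besselPhi ν z = (ν + 1) * besselPhi (ν + 1) z + z * besselPhi (ν + 2) z := by
  have h1 := summable_besselPhi (show -1 < ν + 1 by linarith) z
  have h2 := summable_besselPhi (show -1 < ν + 2 by linarith) z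
  have h3 : Summable fun k : ℕ => (k : ℝ) * (z ^ k /
      ((k.factorial : ℝ) * Real.Gamma (ν + 1 + (k : ℝ) + 1))) := by
    rw [← summable_nat_add_iff 1]
    refine (h2.mul_left z).congr fun k => ?_
    rw [Nat.factorial_succ]
    have : (ν + 1 + ((k + 1 : ℕ) : ℝ) + 1) = ν + 2 + k + 1 := by push_cast; ring
    rw [this]
    have hf : (k.factorial : ℝ) ≠ 0 := by exact_mod_cast k.factorial_ne_zero
    have hk : ((k : ℝ) + 1) ≠ 0 := by positivity
    have hg := (Gamma_nat_shift_pos (show -1 < ν + 2 by linarith) k).ne'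
    push_cast
    field_simp
    ring
  have e3 : ∑' k : ℕ, (k : ℝ) * (z ^ k /
      ((k.factorial : ℝ) * Real.Gamma (ν + 1 + (k : ℝ) + 1))) = z * besselPhi (ν + 2) z := by
    rw [h3.tsum_eq_zero_add]
    unfold besselPhi
    rw [← tsum_mul_left]
    simp only [Nat.cast_zero, zero_mul, zero_add]
    refine tsum_congr fun k => ?_
    rw [Nat.factorial_succ]
    have : (ν + 1 + ((k + 1 : ℕ) : ℝ) + 1) = ν + 2 + k + 1 := by push_cast; ring
    rw [this]
    have hf : (k.factorial : ℝ) ≠ 0 := by exact_mod_cast k.factorial_ne_zero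
    have hk : ((k : ℝ) + 1) ≠ 0 := by positivity
    have hg := (Gamma_nat_shift_pos (show -1 < ν + 2 by linarith) k).ne'
    push_cast
    field_simp
    ring
  rw [← e3]
  unfold besselPhi
  rw [← tsum_mul_left, ← (h1.mul_left (ν + 1)).tsum_add h3]
  refine tsum_congr fun k => ?_
  have hk : (0 : ℝ) ≤ k := k.cast_nonneg
  have : ν + 1 + (k : ℝ) + 1 = (ν + k + 1) + 1 := by ring
  have hne : ν + k + 1 ≠ 0 := by linarith
  rw [this, Real.Gamma_add_one hne]
  have hf : (k.factorial : ℝ) ≠ 0 := by exact_mod_cast k.factorial_ne_zero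
  have hg := (Gamma_nat_shift_pos hν k).ne'
  field_simp
  ring

theorem hasDerivAt_besselPhi {ν : ℝ} (hν : -1 < ν) (z : ℝ) :
    HasDerivAt (besselPhi ν) (besselPhi (ν + 1) z) z := by
  obtain ⟨c, hc, h⟩ := exists_Gamma_nat_shift_lower_bound hν
  set R : ℝ := |z| + 1 with hR
  have hR0 : 0 ≤ R := by positivity
  have hu : Summable fun k : ℕ => c⁻¹ * ((k : ℝ) * R ^ (k - 1) / (k.factorial : ℝ)) := by
    refine Summable.mul_left _ ?_
    rw [← summable_nat_add_iff 1]
    refine (Real.summable_pow_div_factorial R).congr fun k => ?_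
    rw [Nat.factorial_succ]
    have hf : (k.factorial : ℝ) ≠ 0 := by exact_mod_cast k.factorial_ne_zero
    have hk : ((k : ℝ) + 1) ≠ 0 := by positivity
    push_cast
    field_simp
  have key := hasDerivAt_tsum_of_isPreconnected (𝕜 := ℝ) (t := Metric.ball (0 : ℝ) R)
    (g := fun (k : ℕ) (y : ℝ) => y ^ k / ((k.factorial : ℝ) * Real.Gamma (ν + (k : ℝ) + 1)))
    (g' := fun (k : ℕ) (y : ℝ) => (k : ℝ) * y ^ (k - 1) /
      ((k.factorial : ℝ) * Real.Gamma (ν + (k : ℝ) + 1)))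
    (y₀ := 0) (y := z) hu Metric.isOpen_ball (convex_ball _ _).isPreconnected
    (fun k y _ => (hasDerivAt_pow k y).div_const _) ?_ (by simp [hR]; positivity)
    (summable_besselPhi hν 0) (by simp [hR])
  · refine key.congr_deriv ?_
    have hs : Summable fun k : ℕ => (k : ℝ) * z ^ (k - 1) /
        ((k.factorial : ℝ) * Real.Gamma (ν + (k : ℝ) + 1)) := by
      rw [← summable_nat_add_iff 1]
      refine (summable_besselPhi (show -1 < ν + 1 by linarith) z).congr fun k => ?_
      rw [Nat.factorial_succ]
      have : (ν + ((k + 1 : ℕ) : ℝ) + 1) = ν + 1 + k + 1 := by push_cast; ring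
      rw [this]
      have hf : (k.factorial : ℝ) ≠ 0 := by exact_mod_cast k.factorial_ne_zero
      have hk : ((k : ℝ) + 1) ≠ 0 := by positivity
      have hg := (Gamma_nat_shift_pos (show -1 < ν + 1 by linarith) k).ne'
      push_cast
      field_simp
    rw [hs.tsum_eq_zero_add]
    unfold besselPhi
    simp only [Nat.cast_zero, zero_mul, zero_div, zero_add]
    refine tsum_congr fun k => ?_
    rw [Nat.factorial_succ]
    have : (ν + ((k + 1 : ℕ) : ℝ) + 1) = ν + 1 + k + 1 := by push_cast; ring
    rw [this]
    have hf : (k.factorial : ℝ) ≠ 0 := by exact_mod_cast k.factorial_ne_zero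
    have hk : ((k : ℝ) + 1) ≠ 0 := by positivity
    have hg := (Gamma_nat_shift_pos (show -1 < ν + 1 by linarith) k).ne'
    push_cast
    field_simp
  · intro k y hy
    have hy' : |y| ≤ R := by
      have := Metric.mem_ball.1 hy
      rw [Real.dist_eq, sub_zero] at this
      exact this.le
    have hf : (0 : ℝ) < k.factorial := by exact_mod_cast k.factorial_pos
    have hg := Gamma_nat_shift_pos hν k
    rw [Real.norm_eq_abs, abs_div, abs_of_pos (mul_pos hf hg), abs_mul, abs_pow, Nat.abs_cast,
      inv_mul_eq_div, div_div]
    exact div_le_div₀ (by positivity)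
      (mul_le_mul_of_nonneg_left (pow_le_pow_left₀ (abs_nonneg _) hy' _) (Nat.cast_nonneg _))
      (by positivity) (mul_le_mul_of_nonneg_left (h k) hf.le)

theorem besselI_eq_besselPhi (ν : ℝ) {x : ℝ} (hx : 0 < x) :
    besselI ν x = (x / 2) ^ ν * besselPhi ν (x ^ 2 / 4) := by
  unfold besselI besselPhi
  rw [← tsum_mul_left]
  refine tsum_congr fun k => ?_
  have h2 : (x / 2) ^ (2 * (k : ℝ)) = (x ^ 2 / 4) ^ k := by
    rw [Real.rpow_mul (by positivity), Real.rpow_natCast]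
    norm_num [div_pow]
  rw [Real.rpow_add (by positivity), h2]
  ring

theorem besselI_succ_eq_besselPhi (ν : ℝ) {x : ℝ} (hx : 0 < x) :
    besselI (ν + 1) x = (x / 2) ^ ν * (x / 2 * besselPhi (ν + 1) (x ^ 2 / 4)) := by
  rw [besselI_eq_besselPhi _ hx, Real.rpow_add_one (by positivity)]
  ring

theorem besselI_pos {ν x : ℝ} (hν : -1 < ν) (hx : 0 < x) : 0 < besselI ν x := by
  rw [besselI_eq_besselPhi ν hx]
  exact mul_pos (Real.rpow_pos_of_pos (by positivity) _) (besselPhi_pos hν (by positivity))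

theorem hasDerivAt_besselPhi_sq {ν : ℝ} (hν : -1 < ν) (x : ℝ) :
    HasDerivAt (fun y => besselPhi ν (y ^ 2 / 4)) (x / 2 * besselPhi (ν + 1) (x ^ 2 / 4)) x := by
  have h : HasDerivAt (fun y : ℝ => y ^ 2 / 4) (x / 2) x := by
    refine ((hasDerivAt_pow 2 x).div_const 4).congr_deriv ?_
    norm_num; ring
  refine ((hasDerivAt_besselPhi hν (x ^ 2 / 4)).comp x h).congr_deriv ?_
  ring

theorem continuous_besselPhi_sq {ν : ℝ} (hν : -1 < ν) :
    Continuous fun y => besselPhi ν (y ^ 2 / 4) :=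
  continuous_iff_continuousAt.2 fun x => (hasDerivAt_besselPhi_sq hν x).continuousAt

theorem hasDerivAt_half_mul_besselPhi_sq {ν : ℝ} (hν : -1 < ν) (x : ℝ) :
    HasDerivAt (fun y => y / 2 * besselPhi (ν + 1) (y ^ 2 / 4))
      (besselPhi ν (x ^ 2 / 4) - (ν + 1 / 2) * besselPhi (ν + 1) (x ^ 2 / 4)) x := by
  refine (((hasDerivAt_id x).div_const 2).mul
    (hasDerivAt_besselPhi_sq (show -1 < ν + 1 by linarith) x)).congr_deriv ?_
  rw [besselPhi_recurrence hν, show ν + 1 + 1 = ν + 2 by ring]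
  simp only [id]
  ring

/-! ### Ratio bounds for I_{ν+1}/I_ν -/

/-- Integrating factor exp(x). Each ratio bound below takes for f the difference of its two sides,
so that f' + f collapses to a visibly nonnegative expression and only f(0) has to be checked. -/
theorem exp_mul_ge_of_deriv_add_nonneg {f f' : ℝ → ℝ} (hf : ∀ x, HasDerivAt f (f' x) x)
    (h : ∀ x, 0 < x → 0 ≤ f' x + f x) {x : ℝ} (hx : 0 ≤ x) : f 0 ≤ Real.exp x * f x := by
  have hd : ∀ x, HasDerivAt (fun y => Real.exp y * f y)
      (Real.exp x * f x + Real.exp x * f' x) x := fun x => (Real.hasDerivAt_exp x).mul (hf x)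
  have hm : MonotoneOn (fun y => Real.exp y * f y) (Ici 0) := by
    refine monotoneOn_of_deriv_nonneg (convex_Ici 0)
      (fun x _ => (hd x).continuousAt.continuousWithinAt)
      (fun x _ => (hd x).differentiableAt.differentiableWithinAt) fun x hx => ?_
    rw [interior_Ici] at hx
    rw [(hd x).deriv, ← mul_add, add_comm]
    exact mul_nonneg (Real.exp_pos x).le (h x hx)
  simpa using hm (mem_Ici.2 le_rfl) (mem_Ici.2 hx) hx

theorem half_mul_besselPhi_le {ν x : ℝ} (hν : -(1 / 2) ≤ ν) (hx : 0 ≤ x) :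
    x / 2 * besselPhi (ν + 1) (x ^ 2 / 4) ≤ besselPhi ν (x ^ 2 / 4) := by
  have h1 : -1 < ν := by linarith
  have := exp_mul_ge_of_deriv_add_nonneg
    (fun x => (hasDerivAt_besselPhi_sq h1 x).sub (hasDerivAt_half_mul_besselPhi_sq h1 x))
    (fun x hx => by
      have := besselPhi_pos (show -1 < ν + 1 by linarith) (show 0 ≤ x ^ 2 / 4 by positivity)
      simp only [Pi.sub_apply]
      nlinarith) hx
  simp only [Pi.sub_apply] at this
  have h0 : 0 < besselPhi ν (0 ^ 2 / 4) := besselPhi_pos h1 (by norm_num)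
  have h2 : 0 < Real.exp x *
      (besselPhi ν (x ^ 2 / 4) - x / 2 * besselPhi (ν + 1) (x ^ 2 / 4)) := by
    simp only [zero_div, zero_mul, sub_zero] at this
    linarith
  have := pos_of_mul_pos_right h2 (Real.exp_pos x).le
  linarith

/-- With A = Φ_ν and B = (x/2) Φ_{ν+1}, the difference f of the two sides satisfies f' + f = (ν -
1/2)(A - B), nonnegative by `half_mul_besselPhi_le`. Strictness comes from f(0) = (ν + 1/2) A(0) >
0. -/
theorem besselPhi_lower_ratio {ν x : ℝ} (hν : 1 / 2 ≤ ν) (hx : 0 ≤ x) :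
    (x - ν - 1 / 2) * besselPhi ν (x ^ 2 / 4) <
      x * (x / 2 * besselPhi (ν + 1) (x ^ 2 / 4)) := by
  have h1 : -1 < ν := by linarith
  have hd : ∀ x, HasDerivAt (fun y => y * (y / 2 * besselPhi (ν + 1) (y ^ 2 / 4)) -
      (y - ν - 1 / 2) * besselPhi ν (y ^ 2 / 4)) _ x := fun x =>
    ((hasDerivAt_id x).mul (hasDerivAt_half_mul_besselPhi_sq h1 x)).sub
      ((((hasDerivAt_id x).sub_const ν).sub_const (1 / 2)).mul (hasDerivAt_besselPhi_sq h1 x))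
  have := exp_mul_ge_of_deriv_add_nonneg hd
    (fun x hx => by
      have := half_mul_besselPhi_le (show -(1 / 2) ≤ ν by linarith) hx.le
      simp only [id]
      have h3 : 0 ≤ (ν - 1 / 2) *
        (besselPhi ν (x ^ 2 / 4) - x / 2 * besselPhi (ν + 1) (x ^ 2 / 4)) :=
        mul_nonneg (by linarith) (by linarith)
      linear_combination h3) hx
  have h0 : 0 < besselPhi ν (0 ^ 2 / 4) := besselPhi_pos h1 (by norm_num)
  have h4 : 0 < (ν + 1 / 2) * besselPhi ν (0 ^ 2 / 4) := mul_pos (by linarith) h0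
  have h2 := lt_of_lt_of_le (b := (0 : ℝ) * (0 / 2 * besselPhi (ν + 1) (0 ^ 2 / 4)) -
      (0 - ν - 1 / 2) * besselPhi ν (0 ^ 2 / 4)) (a := 0) (by linarith) this
  have := pos_of_mul_pos_right h2 (Real.exp_pos x).le
  linarith

/-- This is the condition S ≤ S' for the weight t^ν with β < 0; it is where ν ≥ 1/2 enters case
(iv). -/
theorem besselPhi_upper_ratio {ν x : ℝ} (hν : 1 / 2 ≤ ν) (hx : 0 ≤ x) :
    (x + 1) * (x / 2 * besselPhi (ν + 1) (x ^ 2 / 4)) ≤ x * besselPhi ν (x ^ 2 / 4) := by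
  have h1 : -1 < ν := by linarith
  have hd : ∀ x, HasDerivAt (fun y => y * besselPhi ν (y ^ 2 / 4) -
      (y + 1) * (y / 2 * besselPhi (ν + 1) (y ^ 2 / 4))) _ x := fun x =>
    ((hasDerivAt_id x).mul (hasDerivAt_besselPhi_sq h1 x)).sub
      (((hasDerivAt_id x).add_const 1).mul (hasDerivAt_half_mul_besselPhi_sq h1 x))
  have := exp_mul_ge_of_deriv_add_nonneg hd
    (fun x hx => by
      have hp := besselPhi_pos (show -1 < ν + 1 by linarith) (show 0 ≤ x ^ 2 / 4 by positivity)
      simp only [id]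
      have h3 : 0 ≤ (x * (ν - 1 / 2) + (ν + 1 / 2)) * besselPhi (ν + 1) (x ^ 2 / 4) :=
        mul_nonneg (add_nonneg (mul_nonneg hx.le (by linarith)) (by linarith)) hp.le
      linear_combination h3) hx
  simp only [zero_mul, zero_div, mul_zero, sub_zero] at this
  have := nonneg_of_mul_nonneg_right this (Real.exp_pos x)
  linarith

theorem besselPhi_succ_le {ν z : ℝ} (hν : -1 < ν) (hz : 0 ≤ z) :
    (ν + 1) * besselPhi (ν + 1) z ≤ besselPhi ν z := by
  rw [besselPhi_recurrence hν]
  have := besselPhi_pos (show -1 < ν + 2 by linarith) hz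
  nlinarith

/-! ### The integral for K_ν: convergence and size -/

theorem cosh_le_exp_abs (y : ℝ) : Real.cosh y ≤ Real.exp |y| := by
  rw [← Real.cosh_abs, Real.cosh_eq]
  have : Real.exp (-|y|) ≤ Real.exp |y| := Real.exp_le_exp.2 (by linarith [abs_nonneg y])
  linarith

theorem cosh_mul_le_exp (ν : ℝ) {t : ℝ} (ht : 0 ≤ t) :
    Real.cosh (ν * t) ≤ Real.exp (|ν| * t) := by
  simpa [abs_mul, abs_of_nonneg ht] using cosh_le_exp_abs (ν * t)

theorem abs_sinh_le_cosh (y : ℝ) : |Real.sinh y| ≤ Real.cosh y := by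
  rw [Real.abs_sinh, ← Real.cosh_abs]
  exact (Real.sinh_lt_cosh _).le

theorem exp_neg_mul_cosh_le {x : ℝ} (hx : 0 < x) (t : ℝ) :
    Real.exp (-x * Real.cosh t) ≤ Real.exp (-(x / 2 * Real.exp t)) := by
  rw [Real.cosh_eq]
  refine Real.exp_le_exp.2 ?_
  have := mul_pos hx (Real.exp_pos (-t))
  linarith

/-- The substitution u = exp t turns this into Euler's integral for Γ. -/
theorem integrable_exp_neg_mul_exp {r μ : ℝ} (hr : 0 < r) (hμ : 0 < μ) :
    Integrable (fun t : ℝ => Real.exp (-(r * Real.exp t)) * Real.exp (μ * t)) ∧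
      ∫ t : ℝ, Real.exp (-(r * Real.exp t)) * Real.exp (μ * t) =
        (1 / r) ^ μ * Real.Gamma μ := by
  have himg : Real.exp '' univ = Ioi 0 := by rw [image_univ, Real.range_exp]
  have hder : ∀ t ∈ (univ : Set ℝ), HasDerivWithinAt Real.exp (Real.exp t) univ t :=
    fun t _ => (Real.hasDerivAt_exp t).hasDerivWithinAt
  have heq : (fun t : ℝ => Real.exp (-(r * Real.exp t)) * Real.exp (μ * t)) = fun t =>
      |Real.exp t| • (Real.exp t ^ (μ - 1) * Real.exp (-(r * Real.exp t))) := by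
    funext t
    rw [abs_of_pos (Real.exp_pos t), smul_eq_mul, ← Real.exp_mul]
    simp only [← Real.exp_add]
    ring_nf
  have hint := Real.integral_rpow_mul_exp_neg_mul_Ioi hμ hr
  have hI : IntegrableOn (fun u : ℝ => u ^ (μ - 1) * Real.exp (-(r * u))) (Ioi 0) := by
    by_contra h
    -- A non-integrable function has integral 0 by convention, but the known value is positive.
    rw [integral_undef h] at hint
    have := mul_pos (Real.rpow_pos_of_pos (one_div_pos.2 hr) μ) (Real.Gamma_pos_of_pos hμ)
    linarith
  rw [heq]
  constructor
  · rw [← integrableOn_univ]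
    refine (integrableOn_image_iff_integrableOn_abs_deriv_smul MeasurableSet.univ hder
      Real.exp_injective.injOn
      (fun u : ℝ => u ^ (μ - 1) * Real.exp (-(r * u)))).1 ?_
    rwa [himg]
  · rw [← hint, ← himg, integral_image_eq_integral_abs_deriv_smul MeasurableSet.univ hder
      Real.exp_injective.injOn, Measure.restrict_univ]

theorem integrableOn_exp_neg_mul_cosh_mul {x : ℝ} (hx : 0 < x) {f : ℝ → ℝ} (hf : Continuous f)
    {C c : ℝ} (h : ∀ t, 0 ≤ t → |f t| ≤ C * Real.exp (c * t)) :
    IntegrableOn (fun t => Real.exp (-x * Real.cosh t) * f t) (Ioi 0) := by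
  have hI := (integrable_exp_neg_mul_exp (half_pos hx)
    (show 0 < |c| + 1 by positivity)).1.integrableOn (s := Ioi 0)
  refine Integrable.mono' (hI.const_mul C) (by fun_prop) ?_
  refine (ae_restrict_iff' measurableSet_Ioi).2 (Eventually.of_forall fun t ht => ?_)
  have ht : 0 < t := ht
  have hC : 0 ≤ C := by
    have := (abs_nonneg _).trans (h 0 le_rfl)
    simpa using this
  rw [Real.norm_eq_abs, abs_mul, abs_of_pos (Real.exp_pos _)]
  calc Real.exp (-x * Real.cosh t) * |f t|
      ≤ Real.exp (-(x / 2 * Real.exp t)) * (C * Real.exp ((|c| + 1) * t)) := by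
        refine mul_le_mul (exp_neg_mul_cosh_le hx t) ((h t ht.le).trans ?_) (abs_nonneg _)
          (Real.exp_pos _).le
        refine mul_le_mul_of_nonneg_left (Real.exp_le_exp.2 ?_) hC
        exact mul_le_mul_of_nonneg_right (by linarith [le_abs_self c]) ht.le
    _ = _ := by ring

theorem tendsto_exp_neg_mul_cosh_mul {x : ℝ} (hx : 0 < x) {f : ℝ → ℝ}
    {c : ℝ} (h : ∀ t, 0 ≤ t → |f t| ≤ Real.exp (c * t)) :
    Tendsto (fun t => Real.exp (-x * Real.cosh t) * f t) atTop (𝓝 0) := by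
  have h1 := (tendsto_rpow_mul_exp_neg_mul_atTop_nhds_zero c (x / 2) (half_pos hx)).comp
    Real.tendsto_exp_atTop
  refine squeeze_zero_norm' ?_ h1
  filter_upwards [eventually_ge_atTop 0] with t ht
  rw [Real.norm_eq_abs, abs_mul, abs_of_pos (Real.exp_pos _), mul_comm]
  simp only [Function.comp_apply]
  rw [← Real.exp_mul, mul_comm t c, neg_mul (x / 2)]
  exact mul_le_mul (h t ht) (exp_neg_mul_cosh_le hx t) (Real.exp_pos _).le (Real.exp_pos _).le

theorem integrableOn_besselK (ν : ℝ) {x : ℝ} (hx : 0 < x) :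
    IntegrableOn (fun t => Real.exp (-x * Real.cosh t) * Real.cosh (ν * t)) (Ioi 0) :=
  integrableOn_exp_neg_mul_cosh_mul hx (by fun_prop) (C := 1) (c := |ν|) fun t ht => by
    rw [abs_of_pos (Real.cosh_pos _), one_mul]
    exact cosh_mul_le_exp ν ht

theorem besselK_nonneg (ν x : ℝ) : 0 ≤ besselK ν x :=
  integral_nonneg fun _ => mul_nonneg (Real.exp_pos _).le (Real.cosh_pos _).le

theorem besselK_le_succ {ν x : ℝ} (hν : -(1 / 2) ≤ ν) (hx : 0 < x) :
    besselK ν x ≤ besselK (ν + 1) x := by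
  refine setIntegral_mono_on (integrableOn_besselK ν hx) (integrableOn_besselK (ν + 1) hx)
    measurableSet_Ioi fun t _ => ?_
  refine mul_le_mul_of_nonneg_left (Real.cosh_le_cosh.2 ?_) (Real.exp_pos _).le
  rw [abs_mul, abs_mul]
  refine mul_le_mul_of_nonneg_right ?_ (abs_nonneg t)
  rw [abs_of_nonneg (show 0 ≤ ν + 1 by linarith)]
  exact abs_le.2 ⟨by linarith, by linarith⟩

/-- Since cosh t exceeds both exp(t)/2 and exp(-t)/2, each half of cosh(μt) can be given its own
bound; the two halves fold into one Γ-integral over the whole line. The constant must be sharp as x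
↓ 0, because it fixes the Wronskian constant. -/
theorem rpow_mul_besselK_le {μ x : ℝ} (hμ : 0 < μ) (hx : 0 < x) :
    x ^ μ * besselK μ x ≤ 2 ^ μ / 2 * Real.Gamma μ := by
  set h : ℝ → ℝ := fun t => Real.exp (-(x / 2 * Real.exp t)) * Real.exp (μ * t) with hh
  obtain ⟨hI, hv⟩ := integrable_exp_neg_mul_exp (half_pos hx) hμ
  have hsum : (∫ t in Ioi (0 : ℝ), h t) + ∫ t in Ioi (0 : ℝ), h (-t) =
      (1 / (x / 2)) ^ μ * Real.Gamma μ := by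
    rw [integral_comp_neg_Ioi, neg_zero, add_comm, ← hv]
    exact intervalIntegral.integral_Iic_add_Ioi hI.integrableOn hI.integrableOn
  have hK : besselK μ x ≤ ∫ t in Ioi (0 : ℝ), (h t + h (-t)) / 2 := by
    refine setIntegral_mono_on (integrableOn_besselK μ hx)
      ((hI.add hI.comp_neg).div_const 2).integrableOn measurableSet_Ioi fun t _ => ?_
    have e1 := mul_le_mul_of_nonneg_right (exp_neg_mul_cosh_le hx t) (Real.exp_pos (μ * t)).le
    have e2 := mul_le_mul_of_nonneg_right (exp_neg_mul_cosh_le hx (-t)) (Real.exp_pos (μ * -t)).le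
    rw [Real.cosh_neg] at e2
    rw [Real.cosh_eq (μ * t), ← mul_neg]
    simp only [hh]
    linarith
  rw [integral_div, integral_add hI.integrableOn hI.comp_neg.integrableOn, hsum] at hK
  calc x ^ μ * besselK μ x ≤ x ^ μ * ((1 / (x / 2)) ^ μ * Real.Gamma μ / 2) :=
        mul_le_mul_of_nonneg_left hK (Real.rpow_nonneg hx.le _)
    _ = (x * (1 / (x / 2))) ^ μ * Real.Gamma μ / 2 := by
        rw [Real.mul_rpow hx.le (by positivity)]; ring
    _ = _ := by
        rw [show x * (1 / (x / 2)) = 2 by field_simp]; ring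

/-! ### Derivative and recurrences of K_ν -/

theorem integrableOn_cosh_mul_besselK (ν : ℝ) {x : ℝ} (hx : 0 < x) :
    IntegrableOn (fun t => Real.exp (-x * Real.cosh t) * (Real.cosh t * Real.cosh (ν * t)))
      (Ioi 0) :=
  integrableOn_exp_neg_mul_cosh_mul hx (by fun_prop) (C := 1) (c := 1 + |ν|) fun t ht => by
    rw [abs_of_pos (mul_pos (Real.cosh_pos _) (Real.cosh_pos _)), one_mul, add_mul, Real.exp_add]
    refine mul_le_mul ?_ (cosh_mul_le_exp ν ht) (Real.cosh_pos _).le (Real.exp_pos _).le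
    simpa using cosh_mul_le_exp 1 ht

theorem hasDerivAt_besselK (ν : ℝ) {x : ℝ} (hx : 0 < x) :
    HasDerivAt (besselK ν)
      (-∫ t in Ioi (0 : ℝ), Real.exp (-x * Real.cosh t) * (Real.cosh t * Real.cosh (ν * t))) x := by
  rw [← integral_neg]
  refine (hasDerivAt_integral_of_dominated_loc_of_deriv_le (𝕜 := ℝ)
    (F := fun y t => Real.exp (-y * Real.cosh t) * Real.cosh (ν * t))
    (F' := fun y t => -(Real.exp (-y * Real.cosh t) * (Real.cosh t * Real.cosh (ν * t))))
    (bound := fun t => Real.exp (-(x / 2) * Real.cosh t) * (Real.cosh t * Real.cosh (ν * t)))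
    (Ioi_mem_nhds (show x / 2 < x by linarith)) ?_ (integrableOn_besselK ν hx) ?_ ?_
    (integrableOn_cosh_mul_besselK ν (half_pos hx)) ?_).2
  · exact Eventually.of_forall fun y => by fun_prop
  · fun_prop
  · refine Eventually.of_forall fun t y hy => ?_
    have hy : x / 2 < y := hy
    have hc := mul_pos (Real.cosh_pos t) (Real.cosh_pos (ν * t))
    rw [norm_neg, Real.norm_eq_abs, abs_of_pos (mul_pos (Real.exp_pos _) hc)]
    refine mul_le_mul_of_nonneg_right (Real.exp_le_exp.2 ?_) hc.le
    exact mul_le_mul_of_nonneg_right (by linarith) (Real.cosh_pos t).le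
  · refine Eventually.of_forall fun t y _ => ?_
    refine ((((hasDerivAt_id y).neg.mul_const (Real.cosh t)).exp).mul_const
      (Real.cosh (ν * t))).congr_deriv ?_
    simp only [id, Pi.neg_apply]
    ring

theorem integral_cosh_mul_besselK (ν : ℝ) {x : ℝ} (hx : 0 < x) :
    ∫ t in Ioi (0 : ℝ), Real.exp (-x * Real.cosh t) * (Real.cosh t * Real.cosh (ν * t)) =
      (besselK (ν + 1) x + besselK (ν - 1) x) / 2 := by
  unfold besselK
  rw [← integral_add (integrableOn_besselK (ν + 1) hx) (integrableOn_besselK (ν - 1) hx),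
    ← integral_div]
  refine integral_congr_ae (Eventually.of_forall fun t => ?_)
  simp only [add_mul, sub_mul, one_mul, Real.cosh_add, Real.cosh_sub]
  ring

/-- Integrate the t-derivative of exp(-x cosh t) sinh(νt), whose boundary values vanish. -/
theorem besselK_recurrence (ν : ℝ) {x : ℝ} (hx : 0 < x) :
    x * (besselK (ν + 1) x - besselK (ν - 1) x) = 2 * ν * besselK ν x := by
  have hs : ∀ t, 0 ≤ t → |Real.sinh (ν * t)| ≤ Real.exp (|ν| * t) := fun t ht =>
    (abs_sinh_le_cosh _).trans (cosh_mul_le_exp ν ht)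
  have hd : IntegrableOn (fun t => Real.exp (-x * Real.cosh t) * Real.cosh ((ν + 1) * t) -
        Real.exp (-x * Real.cosh t) * Real.cosh ((ν - 1) * t)) (Ioi 0) :=
    (integrableOn_besselK (ν + 1) hx).sub (integrableOn_besselK (ν - 1) hx)
  have hI : IntegrableOn (fun t => ν * (Real.exp (-x * Real.cosh t) * Real.cosh (ν * t)) -
      x / 2 * (Real.exp (-x * Real.cosh t) * Real.cosh ((ν + 1) * t) -
        Real.exp (-x * Real.cosh t) * Real.cosh ((ν - 1) * t))) (Ioi 0) :=
    ((integrableOn_besselK ν hx).const_mul _).sub (hd.const_mul _)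
  have key := integral_Ioi_of_hasDerivAt_of_tendsto
    (f := fun t => Real.exp (-x * Real.cosh t) * Real.sinh (ν * t))
    (by fun_prop) (fun t _ => ?_) hI (tendsto_exp_neg_mul_cosh_mul hx hs)
  · rw [integral_sub ((integrableOn_besselK ν hx).const_mul _) (hd.const_mul _),
      integral_const_mul, integral_const_mul,
      integral_sub (integrableOn_besselK (ν + 1) hx) (integrableOn_besselK (ν - 1) hx)] at key
    simp only [mul_zero, Real.sinh_zero, sub_zero] at key
    unfold besselK
    linarith
  · have h1 : HasDerivAt (fun t => Real.exp (-x * Real.cosh t))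
        (Real.exp (-x * Real.cosh t) * (-x * Real.sinh t)) t :=
      ((Real.hasDerivAt_cosh t).const_mul (-x)).exp
    have h2 : HasDerivAt (fun t => Real.sinh (ν * t)) (Real.cosh (ν * t) * (ν * 1)) t :=
      ((hasDerivAt_id t).const_mul ν).sinh
    refine (h1.mul h2).congr_deriv ?_
    simp only [add_mul, sub_mul, one_mul, Real.cosh_add, Real.cosh_sub]
    ring

theorem hasDerivAt_besselK_succ (ν : ℝ) {x : ℝ} (hx : 0 < x) :
    HasDerivAt (besselK ν) (ν / x * besselK ν x - besselK (ν + 1) x) x := by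
  refine (hasDerivAt_besselK ν hx).congr_deriv ?_
  rw [integral_cosh_mul_besselK ν hx]
  have := besselK_recurrence ν hx
  field_simp
  linarith

theorem hasDerivAt_besselK_pred (ν : ℝ) {x : ℝ} (hx : 0 < x) :
    HasDerivAt (besselK (ν + 1)) (-(besselK ν x) - (ν + 1) / x * besselK (ν + 1) x) x := by
  refine (hasDerivAt_besselK (ν + 1) hx).congr_deriv ?_
  rw [integral_cosh_mul_besselK (ν + 1) hx]
  have := besselK_recurrence (ν + 1) hx
  rw [add_sub_cancel_right] at this ⊢
  field_simp
  linarith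

/-! ### Ratio bound for K_{μ+1}/K_μ -/

theorem hasDerivAt_tanh_half (t : ℝ) : HasDerivAt (fun t => Real.tanh (t / 2))
    ((1 - Real.tanh (t / 2) ^ 2) / 2) t := by
  have hc := (Real.cosh_pos (t / 2)).ne'
  have h : HasDerivAt (fun t : ℝ => t / 2) (1 / 2) t := (hasDerivAt_id t).div_const 2
  have := h.sinh.div h.cosh hc
  simp only [Real.tanh_eq_sinh_div_cosh]
  refine this.congr_deriv ?_
  field_simp

theorem continuous_tanh_half : Continuous fun t : ℝ => Real.tanh (t / 2) :=
  continuous_iff_continuousAt.2 fun t => (hasDerivAt_tanh_half t).continuousAt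

theorem abs_tanh_le_one (y : ℝ) : |Real.tanh y| ≤ 1 := by
  rw [Real.tanh_eq_sinh_div_cosh, abs_div, abs_of_pos (Real.cosh_pos y),
    div_le_one (Real.cosh_pos y)]
  exact abs_sinh_le_cosh y

/-- The function exp(-x cosh t) tanh(t/2) cosh(μt) vanishes at 0 and at infinity, so its derivative
Q - P integrates to 0. By the recurrence, ∫ P is the difference of the two sides, and Q ≥ 0
pointwise; at μ = 1/2, Q vanishes identically. -/
theorem besselK_succ_ge {μ x : ℝ} (hμ : 1 / 2 ≤ μ) (hx : 0 < x) :
    (x + μ + 1 / 2) * besselK μ x ≤ x * besselK (μ + 1) x := by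
  set Q : ℝ → ℝ := fun t => Real.exp (-x * Real.cosh t) *
    (μ * Real.tanh (t / 2) * Real.sinh (μ * t) -
      Real.tanh (t / 2) ^ 2 / 2 * Real.cosh (μ * t)) with hQ
  set P : ℝ → ℝ := fun t =>
    x * (Real.exp (-x * Real.cosh t) * (Real.cosh t * Real.cosh (μ * t))) -
      (x + 1 / 2) * (Real.exp (-x * Real.cosh t) * Real.cosh (μ * t)) with hP
  have hT := continuous_tanh_half
  have hQI : IntegrableOn Q (Ioi 0) := by
    refine integrableOn_exp_neg_mul_cosh_mul hx (by fun_prop) (C := μ + 1) (c := μ) fun t ht => ?_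
    have hc := cosh_mul_le_exp μ ht
    rw [abs_of_nonneg (show 0 ≤ μ by linarith)] at hc
    have hs := (abs_sinh_le_cosh (μ * t)).trans hc
    have h1 := abs_tanh_le_one (t / 2)
    refine (abs_sub _ _).trans ?_
    rw [add_mul, one_mul, abs_mul, abs_mul, abs_of_nonneg (show 0 ≤ μ by linarith), abs_mul,
      abs_of_pos (Real.cosh_pos _), abs_div, abs_pow, abs_two]
    refine add_le_add ?_ ?_
    · refine mul_le_mul ?_ hs (abs_nonneg _) (by linarith)
      exact mul_le_of_le_one_right (by linarith) h1
    · have h2 : |Real.tanh (t / 2)| ^ 2 / 2 ≤ 1 := by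
        have := pow_le_one₀ (n := 2) (abs_nonneg _) h1
        linarith
      exact (mul_le_of_le_one_left (Real.cosh_pos _).le h2).trans hc
  have hPI : IntegrableOn P (Ioi 0) :=
    ((integrableOn_cosh_mul_besselK μ hx).const_mul _).sub ((integrableOn_besselK μ hx).const_mul _)
  have key := integral_Ioi_of_hasDerivAt_of_tendsto (m := 0)
    (f := fun t => Real.exp (-x * Real.cosh t) * (Real.tanh (t / 2) * Real.cosh (μ * t)))
    (f' := fun t => Q t - P t) (a := 0)
    (by fun_prop) (fun t _ => ?_) (hQI.sub hPI) (tendsto_exp_neg_mul_cosh_mul hx (c := |μ|)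
      fun t ht => ?_)
  · rw [integral_sub hQI hPI] at key
    have hQ0 : 0 ≤ ∫ t in Ioi (0 : ℝ), Q t := by
      refine setIntegral_nonneg measurableSet_Ioi fun t ht => ?_
      have ht : 0 < t := ht
      refine mul_nonneg (Real.exp_pos _).le ?_
      have hc := Real.cosh_pos (t / 2)
      have hT0 : 0 ≤ Real.tanh (t / 2) := by
        rw [Real.tanh_eq_sinh_div_cosh]
        exact div_nonneg (Real.sinh_nonneg_iff.2 (by linarith)) hc.le
      -- After clearing cosh(t/2) this says sinh((μ - 1/2) t) ≥ 0.
      have h1 : Real.tanh (t / 2) * Real.cosh (μ * t) ≤ Real.sinh (μ * t) := by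
        rw [Real.tanh_eq_sinh_div_cosh, div_mul_eq_mul_div, div_le_iff₀ hc]
        have : 0 ≤ Real.sinh (μ * t - t / 2) :=
          Real.sinh_nonneg_iff.2 (by nlinarith)
        rw [Real.sinh_sub] at this
        linarith
      have h2 : 0 ≤ Real.sinh (μ * t) := Real.sinh_nonneg_iff.2 (by positivity)
      have h3 : 0 ≤ Real.tanh (t / 2) *
          ((Real.sinh (μ * t) - Real.tanh (t / 2) * Real.cosh (μ * t)) / 2 +
            (μ - 1 / 2) * Real.sinh (μ * t)) :=
        mul_nonneg hT0 (add_nonneg (by linarith) (mul_nonneg (by linarith) h2))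
      linear_combination h3
    simp only [hP] at key
    rw [integral_sub ((integrableOn_cosh_mul_besselK μ hx).const_mul _)
      ((integrableOn_besselK μ hx).const_mul _), integral_const_mul, integral_const_mul,
      integral_cosh_mul_besselK μ hx] at key
    simp only [zero_div, Real.tanh_zero, zero_mul, mul_zero, sub_zero] at key
    have hr := besselK_recurrence μ hx
    change _ - (_ - _ * besselK μ x) = (0 : ℝ) at key
    linarith
  · have h1 : HasDerivAt (fun t => Real.exp (-x * Real.cosh t))
        (Real.exp (-x * Real.cosh t) * (-x * Real.sinh t)) t :=
      ((Real.hasDerivAt_cosh t).const_mul (-x)).exp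
    have h2 : HasDerivAt (fun t => Real.cosh (μ * t)) (Real.sinh (μ * t) * (μ * 1)) t :=
      ((hasDerivAt_id t).const_mul μ).cosh
    refine (h1.mul ((hasDerivAt_tanh_half t).mul h2)).congr_deriv ?_
    have h3 : Real.sinh t * Real.tanh (t / 2) = Real.cosh t - 1 := by
      obtain ⟨u, rfl⟩ : ∃ u, t = 2 * u := ⟨t / 2, by ring⟩
      rw [mul_div_cancel_left₀ _ two_ne_zero, Real.sinh_two_mul, Real.cosh_two_mul,
        Real.tanh_eq_sinh_div_cosh, Real.cosh_sq]
      have hc := (Real.cosh_pos u).ne'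
      field_simp
      ring
    simp only [hQ, hP, Pi.mul_apply]
    linear_combination (-x * Real.exp (-x * Real.cosh t) * Real.cosh (μ * t)) * h3
  · rw [abs_mul, abs_of_pos (Real.cosh_pos _)]
    exact (mul_le_of_le_one_left (Real.cosh_pos _).le (abs_tanh_le_one _)).trans
      (cosh_mul_le_exp μ ht)

/-! ### The Wronskian and the product x K_μ I_μ -/

theorem rpow_succ_mul_besselK_le {μ x : ℝ} (hμ : 0 < μ) (hx : 0 < x) :
    x ^ (μ + 1) * besselK μ x ≤ x * (2 ^ μ / 2 * Real.Gamma μ) := by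
  rw [Real.rpow_add_one hx.ne', mul_comm (x ^ μ) x, mul_assoc]
  exact mul_le_mul_of_nonneg_left (rpow_mul_besselK_le hμ hx) hx.le

/-- The Wronskian relation `x (I_μ K_{μ+1} + I_{μ+1} K_μ) ≤ 1`, with the power `(x/2)^μ` of
`I_μ` and `I_{μ+1}` moved over to the other factor. -/
theorem besselPhi_mul_besselK_add_le {μ x : ℝ} (hμ : 0 < μ) (hx : 0 < x) :
    besselPhi μ (x ^ 2 / 4) * (x ^ (μ + 1) * besselK (μ + 1) x) +
      x / 2 * besselPhi (μ + 1) (x ^ 2 / 4) * (x ^ (μ + 1) * besselK μ x) ≤ 2 ^ μ := by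
  have h1 : -1 < μ := by linarith
  set V : ℝ → ℝ := fun x => besselPhi μ (x ^ 2 / 4) * (x ^ (μ + 1) * besselK (μ + 1) x) +
      x / 2 * besselPhi (μ + 1) (x ^ 2 / 4) * (x ^ (μ + 1) * besselK μ x) with hV
  have hd : ∀ y, 0 < y → HasDerivAt V 0 y := by
    intro y hy
    have hp : HasDerivAt (fun y : ℝ => y ^ (μ + 1)) ((μ + 1) * y ^ μ) y := by
      simpa using Real.hasDerivAt_rpow_const (p := μ + 1) (Or.inl hy.ne')
    refine (((hasDerivAt_besselPhi_sq h1 y).mul (hp.mul (hasDerivAt_besselK_pred μ hy))).add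
      ((hasDerivAt_half_mul_besselPhi_sq h1 y).mul
        (hp.mul (hasDerivAt_besselK_succ μ hy)))).congr_deriv ?_
    simp only [Pi.mul_apply]
    rw [Real.rpow_add_one hy.ne']
    field_simp
    ring
  -- V is in fact constant; only V(x) ≤ V(y) for 0 < y < x is needed, since V(y) is then bounded by
  -- an explicit function tending to 2^μ as y ↓ 0.
  have hanti : AntitoneOn V (Ioi 0) := by
    refine antitoneOn_of_deriv_nonpos (convex_Ioi 0)
      (fun y hy => (hd y hy).continuousAt.continuousWithinAt) (fun y hy => ?_) fun y hy => ?_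
    · rw [interior_Ioi] at hy
      exact (hd y hy).differentiableAt.differentiableWithinAt
    · rw [interior_Ioi] at hy
      rw [(hd y hy).deriv]
  have hU : Continuous fun y : ℝ => besselPhi μ (y ^ 2 / 4) * (2 ^ μ * Real.Gamma (μ + 1)) +
      y / 2 * besselPhi (μ + 1) (y ^ 2 / 4) * (y * (2 ^ μ / 2 * Real.Gamma μ)) := by
    have c1 := continuous_besselPhi_sq h1
    have c2 := continuous_besselPhi_sq (show -1 < μ + 1 by linarith)
    fun_prop
  have hlim := (hU.tendsto 0).mono_left (nhdsWithin_le_nhds (s := Ioi 0))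
  have h0 : besselPhi μ (0 ^ 2 / 4) * (2 ^ μ * Real.Gamma (μ + 1)) +
      (0 : ℝ) / 2 * besselPhi (μ + 1) (0 ^ 2 / 4) * (0 * (2 ^ μ / 2 * Real.Gamma μ)) = 2 ^ μ := by
    have := (Real.Gamma_pos_of_pos (show 0 < μ + 1 by linarith)).ne'
    rw [show (0 : ℝ) ^ 2 / 4 = 0 by norm_num, besselPhi_zero]
    field_simp
    simp
  rw [h0] at hlim
  refine ge_of_tendsto hlim ?_
  filter_upwards [Ioo_mem_nhdsGT hx] with y hy
  refine (hanti hy.1 hx hy.2.le).trans (add_le_add ?_ ?_)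
  · refine mul_le_mul_of_nonneg_left ?_ (besselPhi_pos h1 (by positivity)).le
    refine (rpow_mul_besselK_le (show 0 < μ + 1 by linarith) hy.1).trans_eq ?_
    rw [Real.rpow_add_one two_ne_zero]
    ring
  · exact mul_le_mul_of_nonneg_left (rpow_succ_mul_besselK_le hμ hy.1)
      (mul_nonneg (half_pos hy.1).le
        (besselPhi_pos (show -1 < μ + 1 by linarith) (by positivity)).le)

theorem mul_besselK_mul_besselI_eq (μ : ℝ) {x : ℝ} (hx : 0 < x) :
    x * besselK μ x * besselI μ x =
      besselPhi μ (x ^ 2 / 4) * (x ^ (μ + 1) * besselK μ x) / 2 ^ μ := by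
  rw [besselI_eq_besselPhi μ hx, Real.div_rpow hx.le zero_le_two, Real.rpow_add_one hx.ne']
  ring

/-- In the sum of the Wronskian inequality and the two ratio bounds, the terms in μ + 1/2 cancel and
leave 2x. -/
theorem mul_besselK_mul_besselI_lt {μ x : ℝ} (hμ : 1 / 2 ≤ μ) (hx : 0 < x) :
    x * besselK μ x * besselI μ x < 1 / 2 := by
  have h2 : (0 : ℝ) < 2 ^ μ := Real.rpow_pos_of_pos two_pos _
  rw [mul_besselK_mul_besselI_eq μ hx, div_lt_iff₀ h2]
  have hxp : 0 < x ^ (μ + 1) := Real.rpow_pos_of_pos hx _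
  -- Only K_μ ≥ 0 is available, while the strict ratio bound for I must be multiplied by a positive
  -- K_μ.
  rcases (besselK_nonneg μ x).eq_or_lt with h0 | h0
  · rw [← h0]
    simpa using h2
  have hA := besselPhi_pos (show -1 < μ by linarith) (show 0 ≤ x ^ 2 / 4 by positivity)
  have hW := mul_le_mul_of_nonneg_left
    (besselPhi_mul_besselK_add_le (show 0 < μ by linarith) hx) hx.le
  have hK := mul_le_mul_of_nonneg_left
    (mul_le_mul_of_nonneg_left (besselK_succ_ge hμ hx) hxp.le) hA.le
  have hI := mul_lt_mul_of_pos_right (besselPhi_lower_ratio hμ hx.le) (mul_pos hxp h0)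
  have : x * (2 * (besselPhi μ (x ^ 2 / 4) * (x ^ (μ + 1) * besselK μ x))) < x * 2 ^ μ := by
    linear_combination hW + hK + hI
  have := lt_of_mul_lt_mul_left this hx.le
  linarith

theorem tendsto_mul_besselK_mul_besselI {μ : ℝ} (hμ : 0 < μ) :
    Tendsto (fun x => x * besselK μ x * besselI μ x) (𝓝[>] 0) (𝓝 0) := by
  have h1 : -1 < μ := by linarith
  have hU : Continuous fun y : ℝ =>
      besselPhi μ (y ^ 2 / 4) * (y * (2 ^ μ / 2 * Real.Gamma μ)) / 2 ^ μ := by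
    have c1 := continuous_besselPhi_sq h1
    fun_prop
  have hlim := (hU.tendsto 0).mono_left (nhdsWithin_le_nhds (s := Ioi 0))
  simp only [zero_mul, mul_zero, zero_div] at hlim
  refine squeeze_zero' ?_ ?_ hlim
  · filter_upwards [self_mem_nhdsWithin] with x hx
    exact mul_nonneg (mul_nonneg (le_of_lt hx) (besselK_nonneg _ _)) (besselI_pos h1 hx).le
  · filter_upwards [self_mem_nhdsWithin] with x hx
    rw [mul_besselK_mul_besselI_eq μ hx]
    refine div_le_div_of_nonneg_right ?_ (Real.rpow_nonneg zero_le_two _)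
    exact mul_le_mul_of_nonneg_left (rpow_succ_mul_besselK_le hμ hx)
      (besselPhi_pos h1 (by positivity)).le

/-- The limit at 0 is 0, squeezed by the product x K_μ I_μ. -/
theorem ltOnNonneg_of_le {F : ℝ → ℝ} {μ c : ℝ} (hμ : 1 / 2 ≤ μ) (hc : 0 < c)
    (h0 : ∀ x, 0 < x → 0 ≤ F x)
    (hF : ∀ x, 0 < x → F x ≤ c * (x * besselK μ x * besselI μ x)) :
    LtOnNonneg F (c * (1 / 2)) := by
  refine ⟨fun x hx => (hF x hx).trans_lt
    (mul_lt_mul_of_pos_left (mul_besselK_mul_besselI_lt hμ hx) hc), 0, ?_, by positivity⟩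
  have hlim := (tendsto_mul_besselK_mul_besselI (show 0 < μ by linarith)).const_mul c
  rw [mul_zero] at hlim
  refine squeeze_zero' ?_ ?_ hlim
  · filter_upwards [self_mem_nhdsWithin] with x hx using h0 x hx
  · filter_upwards [self_mem_nhdsWithin] with x hx using hF x hx

/-! ### Bounding the integrals -/

/-- `t^(ν+a) I_ν(t)` in terms of the entire function `besselPhi`. -/
theorem rpow_add_mul_besselI (ν a : ℝ) {t : ℝ} (ht : 0 < t) :
    t ^ (ν + a) * besselI ν t = t ^ (2 * ν + a) * besselPhi ν (t ^ 2 / 4) / 2 ^ ν := by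
  rw [besselI_eq_besselPhi ν ht, Real.div_rpow ht.le zero_le_two,
    show 2 * ν + a = (ν + a) + ν by ring, Real.rpow_add ht (ν + a) ν]
  ring

theorem intervalIntegrable_exp_mul_rpow_mul_besselI {ν a : ℝ} (β : ℝ) (hν : -1 < ν)
    (ha : -1 < 2 * ν + a) {x : ℝ} (hx : 0 ≤ x) :
    IntervalIntegrable (fun t => Real.exp (β * t) * t ^ (ν + a) * besselI ν t) volume 0 x := by
  have hc : Continuous fun t => Real.exp (β * t) * besselPhi ν (t ^ 2 / 4) / 2 ^ ν := by
    have := continuous_besselPhi_sq hν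
    fun_prop
  refine ((intervalIntegral.intervalIntegrable_rpow' ha).mul_continuousOn
    hc.continuousOn).congr fun t ht => ?_
  rw [uIoc_of_le hx] at ht
  rw [mul_assoc, rpow_add_mul_besselI ν a ht.1]
  ring

/-- The derivative of exp(βt) S is exp(βt)(S' + βS), and S' + βS ≥ (1 + min β 0) S': for β ≥ 0
because S ≥ 0, for β < 0 because S ≤ S'. -/
theorem integral_exp_mul_le {β : ℝ} (hβ : -1 < β) {f S S' : ℝ → ℝ} {x : ℝ} (hx : 0 ≤ x)
    (hf : IntervalIntegrable (fun t => Real.exp (β * t) * f t) volume 0 x)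
    (hS : Continuous S) (hS0 : S 0 = 0) (hd : ∀ t, 0 < t → HasDerivAt S (S' t) t)
    (hfS : ∀ t, 0 < t → f t ≤ S' t) (hpos : ∀ t, 0 < t → 0 ≤ S t)
    (hle : β < 0 → ∀ t, 0 < t → S t ≤ S' t) :
    (∫ t in (0 : ℝ)..x, Real.exp (β * t) * f t) ≤
      (1 + min β 0)⁻¹ * (Real.exp (β * x) * S x) := by
  have hm : 0 < 1 + min β 0 := by
    have := lt_min hβ (show (-1 : ℝ) < 0 by norm_num)
    linarith
  have key := intervalIntegral.integral_le_sub_of_hasDeriv_right_of_le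
    (g := fun t => (1 + min β 0)⁻¹ * (Real.exp (β * t) * S t))
    (g' := fun t => (1 + min β 0)⁻¹ * (Real.exp (β * t) * (β * 1) * S t +
      Real.exp (β * t) * S' t))
    (φ := fun t => Real.exp (β * t) * f t) hx (by fun_prop)
    (fun t ht => (((((hasDerivAt_id t).const_mul β).exp).mul (hd t ht.1)).const_mul
      _).hasDerivWithinAt)
    ((intervalIntegrable_iff_integrableOn_Icc_of_le hx).1 hf) fun t ht => ?_
  · simpa [hS0] using key
  · rw [inv_mul_eq_div, le_div_iff₀ hm]
    have h1 : (1 + min β 0) * f t ≤ S' t + β * S t := by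
      refine (mul_le_mul_of_nonneg_left (hfS t ht.1) hm.le).trans ?_
      rcases lt_or_ge β 0 with hb | hb
      · rw [min_eq_left hb.le]
        nlinarith [hle hb t ht.1]
      · rw [min_eq_right hb]
        nlinarith [mul_nonneg hb (hpos t ht.1)]
    have h2 := mul_le_mul_of_nonneg_left h1 (Real.exp_pos (β * t)).le
    linear_combination h2

/-- The power contributes (ν + a/2) Φ_{ν+1} and the other factor -(ν + 1/2) Φ_{ν+1}. For a = 1 they
cancel: this is (t^(ν+1) I_{ν+1})' = t^(ν+1) I_ν. -/
theorem hasDerivAt_rpow_mul_besselPhi {ν a t : ℝ} (hν : -1 < ν) (ht : 0 < t) :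
    HasDerivAt (fun t => t ^ (2 * ν + 1 + a) * besselPhi (ν + 1) (t ^ 2 / 4) / 2)
      (t ^ (2 * ν + a) * (besselPhi ν (t ^ 2 / 4) +
        (a - 1) / 2 * besselPhi (ν + 1) (t ^ 2 / 4))) t := by
  have hp := Real.hasDerivAt_rpow_const (p := 2 * ν + a) (Or.inl ht.ne')
  have h := hp.mul (hasDerivAt_half_mul_besselPhi_sq hν t)
  have heq : (fun t => t ^ (2 * ν + 1 + a) * besselPhi (ν + 1) (t ^ 2 / 4) / 2) =ᶠ[𝓝 t]
      (fun t => t ^ (2 * ν + a)) * fun y => y / 2 * besselPhi (ν + 1) (y ^ 2 / 4) := by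
    filter_upwards [Ioi_mem_nhds ht] with y hy
    rw [Pi.mul_apply, show 2 * ν + 1 + a = 2 * ν + a + 1 by ring,
      Real.rpow_add_one (ne_of_gt hy)]
    ring
  refine (h.congr_of_eventuallyEq heq).congr_deriv ?_
  rw [Real.rpow_sub_one ht.ne']
  field_simp
  ring

theorem rpow_add_mul_besselI_succ (ν a : ℝ) {t : ℝ} (ht : 0 < t) :
    t ^ (ν + a) * besselI (ν + 1) t =
      t ^ (2 * ν + 1 + a) * besselPhi (ν + 1) (t ^ 2 / 4) / 2 / 2 ^ ν := by
  rw [besselI_succ_eq_besselPhi ν ht, Real.div_rpow ht.le zero_le_two,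
    show 2 * ν + 1 + a = ν + a + ν + 1 by ring, Real.rpow_add_one ht.ne',
    Real.rpow_add ht (ν + a) ν]
  ring

/-- For `a = 1` and `a = 0` this is an upper bound for `∫₀ˣ exp(βt) t^(ν+a) I_ν(t) dt` in terms of
`x^(ν+a) I_{ν+1}(x)`, provided `t^(2ν+1+a) I_{ν+1}(t)` grows fast enough. -/
theorem integral_exp_mul_rpow_mul_besselI_le {β ν a κ : ℝ} (hβ : -1 < β) (hν : -1 < ν)
    (ha : -1 < 2 * ν + a) (hκ : 0 ≤ κ)
    (hfS : ∀ t, 0 < t → besselPhi ν (t ^ 2 / 4) ≤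
      κ * (besselPhi ν (t ^ 2 / 4) + (a - 1) / 2 * besselPhi (ν + 1) (t ^ 2 / 4)))
    (hle : β < 0 → ∀ t, 0 < t → t / 2 * besselPhi (ν + 1) (t ^ 2 / 4) ≤
      besselPhi ν (t ^ 2 / 4) + (a - 1) / 2 * besselPhi (ν + 1) (t ^ 2 / 4))
    {x : ℝ} (hx : 0 < x) :
    (∫ t in (0 : ℝ)..x, Real.exp (β * t) * t ^ (ν + a) * besselI ν t) ≤
      (1 + min β 0)⁻¹ * κ * (Real.exp (β * x) * (x ^ (ν + a) * besselI (ν + 1) x)) := by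
  have h2 : (0 : ℝ) < 2 ^ ν := Real.rpow_pos_of_pos two_pos _
  have h1 : -1 < ν + 1 := by linarith
  have key := integral_exp_mul_le (f := fun t => t ^ (ν + a) * besselI ν t)
    (S := fun t => κ / 2 ^ ν * (t ^ (2 * ν + 1 + a) * besselPhi (ν + 1) (t ^ 2 / 4) / 2))
    (S' := fun t => κ / 2 ^ ν * (t ^ (2 * ν + a) * (besselPhi ν (t ^ 2 / 4) +
        (a - 1) / 2 * besselPhi (ν + 1) (t ^ 2 / 4)))) hβ hx.le
    (by simpa only [mul_assoc] using
      intervalIntegrable_exp_mul_rpow_mul_besselI β hν ha hx.le) ?_ ?_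
    (fun t ht => (hasDerivAt_rpow_mul_besselPhi hν ht).const_mul _)
    (fun t ht => ?_) (fun t ht => ?_) (fun hb t ht => ?_)
  · simp only [mul_assoc]
    refine key.trans_eq ?_
    rw [rpow_add_mul_besselI_succ ν a hx]
    ring
  · have c1 := continuous_besselPhi_sq h1
    have c2 : Continuous fun t : ℝ => t ^ (2 * ν + 1 + a) :=
      Real.continuous_rpow_const (by linarith)
    fun_prop
  · rw [Real.zero_rpow (by linarith)]
    ring
  · rw [rpow_add_mul_besselI ν a ht]
    have := mul_le_mul_of_nonneg_left (hfS t ht)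
      (div_nonneg (Real.rpow_nonneg ht.le (2 * ν + a)) h2.le)
    linear_combination this
  · have := besselPhi_pos h1 (show 0 ≤ t ^ 2 / 4 by positivity)
    have := Real.rpow_nonneg ht.le (2 * ν + 1 + a)
    positivity
  · have := mul_le_mul_of_nonneg_left (hle hb t ht)
      (mul_nonneg (div_nonneg hκ h2.le) (Real.rpow_nonneg ht.le (2 * ν + a)))
    rw [show 2 * ν + 1 + a = 2 * ν + a + 1 by ring, Real.rpow_add_one ht.ne']
    linear_combination this

/-! ### Assembly of the four cases -/

theorem ltOnNonneg_pair {β ν a κ : ℝ} (hβ : -1 < β) (hν : -(1 / 2) < ν)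
    (ha : -1 < 2 * ν + a) (hκ : 0 < κ)
    (hfS : ∀ t, 0 < t → besselPhi ν (t ^ 2 / 4) ≤
      κ * (besselPhi ν (t ^ 2 / 4) + (a - 1) / 2 * besselPhi (ν + 1) (t ^ 2 / 4)))
    (hle : β < 0 → ∀ t, 0 < t → t / 2 * besselPhi (ν + 1) (t ^ 2 / 4) ≤
      besselPhi ν (t ^ 2 / 4) + (a - 1) / 2 * besselPhi (ν + 1) (t ^ 2 / 4)) :
    LtOnNonneg (fun x => Real.exp (-β * x) * besselK (ν + 1) x / x ^ (ν + a - 1) *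
        ∫ t in (0 : ℝ)..x, Real.exp (β * t) * t ^ (ν + a) * besselI ν t)
      ((1 + min β 0)⁻¹ * κ * (1 / 2)) ∧
    LtOnNonneg (fun x => Real.exp (-β * x) * besselK ν x / x ^ (ν + a - 1) *
        ∫ t in (0 : ℝ)..x, Real.exp (β * t) * t ^ (ν + a) * besselI ν t)
      ((1 + min β 0)⁻¹ * κ * (1 / 2)) := by
  have hm : 0 < (1 + min β 0)⁻¹ := by
    have := lt_min hβ (show (-1 : ℝ) < 0 by norm_num)
    exact inv_pos.2 (by linarith)
  have hint : ∀ x : ℝ, 0 < x →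
      0 ≤ ∫ t in (0 : ℝ)..x, Real.exp (β * t) * t ^ (ν + a) * besselI ν t := by
    intro x hx
    rw [intervalIntegral.integral_of_le hx.le]
    refine setIntegral_nonneg measurableSet_Ioc fun t ht => ?_
    exact mul_nonneg (mul_nonneg (Real.exp_pos _).le (Real.rpow_nonneg ht.1.le _))
      (besselI_pos (by linarith) ht.1).le
  have hnn : ∀ μ x : ℝ, 0 < x → 0 ≤ Real.exp (-β * x) * besselK μ x / x ^ (ν + a - 1) :=
    fun μ x hx => div_nonneg (mul_nonneg (Real.exp_pos _).le (besselK_nonneg _ _))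
      (Real.rpow_nonneg hx.le _)
  have hmain : ∀ x : ℝ, 0 < x → Real.exp (-β * x) * besselK (ν + 1) x / x ^ (ν + a - 1) *
        (∫ t in (0 : ℝ)..x, Real.exp (β * t) * t ^ (ν + a) * besselI ν t) ≤
      (1 + min β 0)⁻¹ * κ * (x * besselK (ν + 1) x * besselI (ν + 1) x) := by
    intro x hx
    refine (mul_le_mul_of_nonneg_left (integral_exp_mul_rpow_mul_besselI_le hβ (by linarith) ha
      hκ.le hfS hle hx) (hnn _ x hx)).trans_eq ?_
    have hp := (Real.rpow_pos_of_pos hx (ν + a)).ne'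
    rw [Real.rpow_sub_one hx.ne', neg_mul, Real.exp_neg]
    field_simp
  refine ⟨ltOnNonneg_of_le (by linarith) (mul_pos hm hκ)
    (fun x hx => mul_nonneg (hnn _ x hx) (hint x hx)) hmain,
    -- The order stays ν + 1 for the K_ν version too, since ν itself may be below 1/2.
    ltOnNonneg_of_le (μ := ν + 1) (by linarith) (mul_pos hm hκ)
    (fun x hx => mul_nonneg (hnn _ x hx) (hint x hx)) fun x hx => le_trans ?_ (hmain x hx)⟩
  refine mul_le_mul_of_nonneg_right ?_ (hint x hx)
  refine div_le_div_of_nonneg_right ?_ (Real.rpow_nonneg hx.le _)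
  exact mul_le_mul_of_nonneg_left (besselK_le_succ hν.le hx) (Real.exp_pos _).le

theorem ltOnNonneg_pair_of_rpow_succ {β ν : ℝ} (hβ : -1 < β) (hν : -(1 / 2) < ν) :
    LtOnNonneg (fun x => Real.exp (-β * x) * besselK (ν + 1) x / x ^ ν *
        ∫ t in (0 : ℝ)..x, Real.exp (β * t) * t ^ (ν + 1) * besselI ν t)
      ((1 + min β 0)⁻¹ * (1 / 2)) ∧
    LtOnNonneg (fun x => Real.exp (-β * x) * besselK ν x / x ^ ν *
        ∫ t in (0 : ℝ)..x, Real.exp (β * t) * t ^ (ν + 1) * besselI ν t)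
      ((1 + min β 0)⁻¹ * (1 / 2)) := by
  have := ltOnNonneg_pair (a := 1) (κ := 1) hβ hν (by linarith) one_pos
    (fun t _ => by simp) (fun _ t ht => by simpa using half_mul_besselPhi_le hν.le ht.le)
  simpa only [add_sub_cancel_right, mul_one] using this

theorem ltOnNonneg_pair_of_rpow {β ν : ℝ} (hβ : -1 < β) (hν : -(1 / 2) < ν)
    (hβν : β < 0 → 1 / 2 ≤ ν) :
    LtOnNonneg (fun x => Real.exp (-β * x) * besselK (ν + 1) x / x ^ (ν - 1) *
        ∫ t in (0 : ℝ)..x, Real.exp (β * t) * t ^ ν * besselI ν t)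
      ((1 + min β 0)⁻¹ * ((ν + 1) / (2 * ν + 1))) ∧
    LtOnNonneg (fun x => Real.exp (-β * x) * besselK ν x / x ^ (ν - 1) *
        ∫ t in (0 : ℝ)..x, Real.exp (β * t) * t ^ ν * besselI ν t)
      ((1 + min β 0)⁻¹ * ((ν + 1) / (2 * ν + 1))) := by
  have h1 : 0 < 2 * ν + 1 := by linarith
  have h2 : 0 < ν + 1 := by linarith
  -- κ is the constant for which (ν+1) Φ_{ν+1} ≤ Φ_ν yields Φ_ν ≤ κ (Φ_ν - Φ_{ν+1}/2).
  have := ltOnNonneg_pair (a := 0) (κ := 2 * ((ν + 1) / (2 * ν + 1))) hβ hν (by linarith)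
    (by positivity)
    (fun t _ => by
      have := besselPhi_succ_le (show -1 < ν by linarith) (show 0 ≤ t ^ 2 / 4 by positivity)
      rw [← mul_div_assoc, div_mul_eq_mul_div, le_div_iff₀ h1]
      linarith)
    (fun hb t ht => by
      have := besselPhi_upper_ratio (hβν hb) ht.le
      refine le_of_mul_le_mul_left ?_ ht
      linarith)
  have e : (1 + min β 0)⁻¹ * (2 * ((ν + 1) / (2 * ν + 1))) * (1 / 2) =
      (1 + min β 0)⁻¹ * ((ν + 1) / (2 * ν + 1)) := by ring
  simpa only [add_zero, e] using this

theorem mainTheorem3 :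
    -- the integrands are integrable
    (∀ β ν : ℝ, -(1 / 2) < ν → ∀ x : ℝ, 0 ≤ x →
      IntervalIntegrable (fun t => Real.exp (β * t) * t ^ (ν + 1) * besselI ν t) volume 0 x ∧
      IntervalIntegrable (fun t => Real.exp (β * t) * t ^ ν * besselI ν t) volume 0 x) ∧
    -- (i)
    (∀ β ν : ℝ, 0 ≤ β → -(1 / 2) < ν →
      LtOnNonneg (fun x => Real.exp (-β * x) * besselK (ν + 1) x / x ^ ν *
        ∫ t in (0 : ℝ)..x, Real.exp (β * t) * t ^ (ν + 1) * besselI ν t) (1 / 2) ∧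
      LtOnNonneg (fun x => Real.exp (-β * x) * besselK ν x / x ^ ν *
        ∫ t in (0 : ℝ)..x, Real.exp (β * t) * t ^ (ν + 1) * besselI ν t) (1 / 2)) ∧
    -- (ii)
    (∀ β ν : ℝ, 0 ≤ β → -(1 / 2) < ν →
      LtOnNonneg (fun x => Real.exp (-β * x) * besselK (ν + 1) x / x ^ (ν - 1) *
        ∫ t in (0 : ℝ)..x, Real.exp (β * t) * t ^ ν * besselI ν t) ((ν + 1) / (2 * ν + 1)) ∧
      LtOnNonneg (fun x => Real.exp (-β * x) * besselK ν x / x ^ (ν - 1) *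
        ∫ t in (0 : ℝ)..x, Real.exp (β * t) * t ^ ν * besselI ν t) ((ν + 1) / (2 * ν + 1))) ∧
    -- (iii)
    (∀ β ν : ℝ, -1 < β → β < 0 → -(1 / 2) < ν →
      LtOnNonneg (fun x => Real.exp (-β * x) * besselK (ν + 1) x / x ^ ν *
        ∫ t in (0 : ℝ)..x, Real.exp (β * t) * t ^ (ν + 1) * besselI ν t) (1 / (2 * (1 + β))) ∧
      LtOnNonneg (fun x => Real.exp (-β * x) * besselK ν x / x ^ ν *
        ∫ t in (0 : ℝ)..x, Real.exp (β * t) * t ^ (ν + 1) * besselI ν t) (1 / (2 * (1 + β)))) ∧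
    -- (iv)
    (∀ β ν : ℝ, -1 < β → β < 0 → 1 / 2 ≤ ν →
      LtOnNonneg (fun x => Real.exp (-β * x) * besselK (ν + 1) x / x ^ (ν - 1) *
        ∫ t in (0 : ℝ)..x, Real.exp (β * t) * t ^ ν * besselI ν t) ((ν + 1) / ((2 * ν + 1) * (1 + β))) ∧
      LtOnNonneg (fun x => Real.exp (-β * x) * besselK ν x / x ^ (ν - 1) *
        ∫ t in (0 : ℝ)..x, Real.exp (β * t) * t ^ ν * besselI ν t) ((ν + 1) / ((2 * ν + 1) * (1 + β)))) := by
  refine ⟨fun β ν hν x hx => ⟨?_, ?_⟩, fun β ν hβ hν => ?_, fun β ν hβ hν => ?_,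
    fun β ν hβ hβ' hν => ?_, fun β ν hβ hβ' hν => ?_⟩
  · exact intervalIntegrable_exp_mul_rpow_mul_besselI β (by linarith) (by linarith) hx
  · simpa only [add_zero] using
      intervalIntegrable_exp_mul_rpow_mul_besselI (a := 0) β (by linarith) (by linarith) hx
  · have := ltOnNonneg_pair_of_rpow_succ (show -1 < β by linarith) hν
    simpa only [min_eq_right hβ, add_zero, inv_one, one_mul] using this
  · have := ltOnNonneg_pair_of_rpow (show -1 < β by linarith) hν fun h => absurd hβ h.not_ge
    simpa only [min_eq_right hβ, add_zero, inv_one, one_mul] using this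
  · have := ltOnNonneg_pair_of_rpow_succ hβ hν
    have e : (1 + β)⁻¹ * (1 / 2) = 1 / (2 * (1 + β)) := by
      rw [inv_mul_eq_div, div_div]
    simpa only [min_eq_left hβ'.le, e] using this
  · have := ltOnNonneg_pair_of_rpow hβ (show -(1 / 2) < ν by linarith) fun _ => hν
    have e : (1 + β)⁻¹ * ((ν + 1) / (2 * ν + 1)) = (ν + 1) / ((2 * ν + 1) * (1 + β)) := by
      rw [inv_mul_eq_div, div_div]
    simpa only [min_eq_left hβ'.le, e] using this
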